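/- Let $n,m,p\in\mathbb N$, let $A:\mathbb R^p\to\mathbb R^{n\times n}$ and $B:\mathbb R^p\to\mathbb R^{n\times m}$ be affine, and let $Q\in\mathbb R^{n\times n}$, $R\in\mathbb R^{m\times m}$ be symmetric positive definite. Let $\Theta\subset\mathbb R^p$ be compact and convex, and suppose that for every $\theta\in\Theta$ the pair $(A(\theta),B(\theta))$ is stabilizable, i.e. there is a matrix $K$ such that all eigenvalues of $A(\theta)+B(\theta)K$ have modulus less than $1$. Let $\bar W\ge 0$. Then for every $\theta\in\Theta$ the discrete-time algebraic Riccati equation $$P=A(\theta)^\top PA(\theta)-A(\theta)^\top PB(\theta)\bigl(R+B(\theta)^\top PB(\theta)\bigr)^{-1}B(\theta)^\top PA(\theta)+Q$$ has a unique positive definite solution $P=P(\theta)$. Put $K_{\mathrm{LQR}}(\theta)=-(R+B(\theta)^\top P(\theta)B(\theta))^{-1}B(\theta)^\top P(\theta)A(\theta)$ and $V(x,\theta)=x^\top P(\theta)x$, and let $\|\cdot\|$ be the Euclidean norm. Moreover, there exist constants $\alpha,\nu_2,\nu_3,\nu_4>0$, depending only on $A,B,Q,R,\Theta,\bar W$,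 such that for all $X\in\mathbb R$ and $\mu>0$ there are constants $\beta,\gamma>0$ with $$\beta=\nu_2\mu X^2+\nu_3\mu+\nu_4$$ for which the following holds. Let $(x_k)$, $(u_k)$, $(w_k)$, $(\theta_k)$, $(\hat\theta_k)$, $k\in\mathbb N=\{0,1,2,\dots\}$, be any sequences in $\mathbb R^n,\mathbb R^m,\mathbb R^n,\mathbb R^p,\mathbb R^p$, respectively, with $$x_{k+1}=A(\theta_k)x_k+B(\theta_k)u_k+w_k,\qquad u_k=K_{\mathrm{LQR}}(\hat\theta_k)x_k,$$ $\|w_k\|\le\bar W$, $\theta_k\in\Theta$, $\hat\theta_k\in\Theta$ and $\|x_k\|\le X$ for all $k\in\mathbb N$, and let $e_{1|k}=x_{k+1}-A(\hat\theta_k)x_k-B(\hat\theta_k)u_k-w_k$. If $$\|\hat\theta_{k+1}-\hat\theta_k\|\le\sqrt\mu\,\|e_{1|k}+w_k\|\quad\text{for all }k\in\mathbb N,$$ then $$V(x_{k+1},\hat\theta_{k+1})-V(x_k,\hat\theta_k)\le-\alpha\|x_k\|^2+\beta\|e_{1|k}\|^2+\gamma\|w_k\|^2\quad\text{for all }k\in\mathbb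 N.$$ -/

import Mathlib

open Matrix

noncomputable section

namespace AdaptiveLQR

/-- A real square matrix is Schur stable if all its complex eigenvalues lie in the open unit disc. -/
def IsSchur {n : ℕ} (M : Matrix (Fin n) (Fin n) ℝ) : Prop :=
  ∀ z ∈ spectrum ℂ (M.map (algebraMap ℝ ℂ)), ‖z‖ < 1

/-- The pair `(A, B)` is stabilizable if some static state feedback `u = K x` makes the
closed-loop matrix `A + B K` Schur stable. -/
def IsStabilizable {n m : ℕ} (A : Matrix (Fin n) (Fin n) ℝ) (B : Matrix (Fin n) (Fin m) ℝ) :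
    Prop :=
  ∃ K : Matrix (Fin m) (Fin n) ℝ, IsSchur (A + B * K)

/-- `P` is a positive definite solution of the discrete-time algebraic Riccati equation. -/
def IsRiccatiSolution {n m : ℕ} (A : Matrix (Fin n) (Fin n) ℝ) (B : Matrix (Fin n) (Fin m) ℝ)
    (Q : Matrix (Fin n) (Fin n) ℝ) (R : Matrix (Fin m) (Fin m) ℝ)
    (P : Matrix (Fin n) (Fin n) ℝ) : Prop :=
  P.PosDef ∧
    P = Aᵀ * P * A - Aᵀ * P * B * (R + Bᵀ * P * B)⁻¹ * Bᵀ * P * A + Q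

open Classical in
/-- The positive definite solution of the discrete-time algebraic Riccati equation
(with value `0` if there is none). -/
def riccatiP {n m : ℕ} (A : Matrix (Fin n) (Fin n) ℝ) (B : Matrix (Fin n) (Fin m) ℝ)
    (Q : Matrix (Fin n) (Fin n) ℝ) (R : Matrix (Fin m) (Fin m) ℝ) :
    Matrix (Fin n) (Fin n) ℝ :=
  if h : ∃ P, IsRiccatiSolution A B Q R P then h.choose else 0

/-- The LQR gain `K = -(R + Bᵀ P B)⁻¹ Bᵀ P A`, where `P` solves the Riccati equation. -/
def lqrGain {n m : ℕ} (A : Matrix (Fin n) (Fin n) ℝ) (B : Matrix (Fin n) (Fin m) ℝ)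
    (Q : Matrix (Fin n) (Fin n) ℝ) (R : Matrix (Fin m) (Fin m) ℝ) :
    Matrix (Fin m) (Fin n) ℝ :=
  -((R + Bᵀ * riccatiP A B Q R * B)⁻¹ * Bᵀ * riccatiP A B Q R * A)

/-- The product of a matrix with a vector, between Euclidean spaces. -/
def mulE {a b : ℕ} (M : Matrix (Fin a) (Fin b) ℝ) (v : EuclideanSpace ℝ (Fin b)) :
    EuclideanSpace ℝ (Fin a) :=
  WithLp.toLp 2 (M *ᵥ v.ofLp)

/-- The function `V(x, θ) = xᵀ P(θ) x`. -/
def lyapunovV {n m p : ℕ}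
    (A : EuclideanSpace ℝ (Fin p) →ᵃ[ℝ] Matrix (Fin n) (Fin n) ℝ)
    (B : EuclideanSpace ℝ (Fin p) →ᵃ[ℝ] Matrix (Fin n) (Fin m) ℝ)
    (Q : Matrix (Fin n) (Fin n) ℝ) (R : Matrix (Fin m) (Fin m) ℝ)
    (x : EuclideanSpace ℝ (Fin n)) (θ : EuclideanSpace ℝ (Fin p)) : ℝ :=
  x.ofLp ⬝ᵥ (riccatiP (A θ) (B θ) Q R *ᵥ x.ofLp)

/-- The nominal prediction `A(θ) x + B(θ) u` of the next state. -/
def prediction {n m p : ℕ}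
    (A : EuclideanSpace ℝ (Fin p) →ᵃ[ℝ] Matrix (Fin n) (Fin n) ℝ)
    (B : EuclideanSpace ℝ (Fin p) →ᵃ[ℝ] Matrix (Fin n) (Fin m) ℝ)
    (θ : EuclideanSpace ℝ (Fin p)) (x : EuclideanSpace ℝ (Fin n))
    (u : EuclideanSpace ℝ (Fin m)) : EuclideanSpace ℝ (Fin n) :=
  mulE (A θ) x + mulE (B θ) u

/-- The 1-step nominal prediction error `x₊ - (A(θ̂) x + B(θ̂) u) - w`, where `xnext = x₊` is the
next state and `θhat = θ̂` the parameter estimate. -/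
def predError {n m p : ℕ}
    (A : EuclideanSpace ℝ (Fin p) →ᵃ[ℝ] Matrix (Fin n) (Fin n) ℝ)
    (B : EuclideanSpace ℝ (Fin p) →ᵃ[ℝ] Matrix (Fin n) (Fin m) ℝ)
    (θhat : EuclideanSpace ℝ (Fin p)) (x : EuclideanSpace ℝ (Fin n))
    (u : EuclideanSpace ℝ (Fin m)) (xnext w : EuclideanSpace ℝ (Fin n)) :
    EuclideanSpace ℝ (Fin n) :=
  xnext - prediction A B θhat x u - w

end AdaptiveLQR

end

noncomputable section

namespace AdaptiveLQR

open Filter Topology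
open scoped Matrix.Norms.L2Operator

/-! The Riccati map is one step of dynamic programming: by completing the square (`bellman_eq`), its
quadratic form is the minimum over inputs of stage cost plus cost-to-go. Everything rests on the
comparison principle `quadForm_le_of_supersolution`. It gives uniqueness at once; existence is value
iteration from `0`, bounded above by the cost of a stabilizing feedback. It also gives regularity in
the parameter without differentiating the equation: a slightly inflated P(θ) is a supersolution for
every nearby θ', so P is locally bounded, hence bounded by some M on the compact Θ, and then
Lipschitz with some constant L.

For the decrease, the next state z is the nominal closed-loop state plus d = e + w. The Bellman
equation at a frozen estimate yields -q‖x‖², Young's inequality absorbs the cross term with d, and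
updating the estimate costs at most L√μ‖d‖‖z‖². Bounding one factor ‖z‖ by X and the other by κ‖x‖ +
‖d‖ turns this into a share of q‖x‖² plus a multiple of ‖d‖² that is affine in μX². -/

/-- The quadratic form `xᵀ P x`. -/
def quadForm {n : ℕ} (P : Matrix (Fin n) (Fin n) ℝ) (x : EuclideanSpace ℝ (Fin n)) : ℝ :=
  x.ofLp ⬝ᵥ (P *ᵥ x.ofLp)

/-! ### Quadratic forms and matrix-vector products. -/

section Basic

variable {n m l : ℕ}

lemma quadForm_add_matrix (P S : Matrix (Fin n) (Fin n) ℝ) (x : EuclideanSpace ℝ (Fin n)) :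
    quadForm (P + S) x = quadForm P x + quadForm S x := by
  simp [quadForm, add_mulVec, dotProduct_add]

lemma quadForm_zero_matrix (x : EuclideanSpace ℝ (Fin n)) :
    quadForm (0 : Matrix (Fin n) (Fin n) ℝ) x = 0 := by
  simp [quadForm]

lemma quadForm_add (P : Matrix (Fin n) (Fin n) ℝ) (x y : EuclideanSpace ℝ (Fin n)) :
    quadForm P (x + y) = quadForm P x + quadForm P y
      + (x.ofLp ⬝ᵥ (P *ᵥ y.ofLp) + y.ofLp ⬝ᵥ (P *ᵥ x.ofLp)) := by
  simp only [quadForm, WithLp.ofLp_add, mulVec_add, dotProduct_add, add_dotProduct]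
  ring

lemma quadForm_smul_sub (P : Matrix (Fin n) (Fin n) ℝ) (s : ℝ) (x y : EuclideanSpace ℝ (Fin n)) :
    quadForm P (s • x - y) = s ^ 2 * quadForm P x + quadForm P y
      - s * (x.ofLp ⬝ᵥ (P *ᵥ y.ofLp) + y.ofLp ⬝ᵥ (P *ᵥ x.ofLp)) := by
  simp only [quadForm, WithLp.ofLp_sub, WithLp.ofLp_smul, mulVec_sub, dotProduct_sub,
    sub_dotProduct, mulVec_smul, dotProduct_smul, smul_dotProduct, smul_eq_mul]
  ring

/-- Young's inequality: nonnegativity at `s • x - y`, divided by `s`, bounds the cross term.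
Symmetry of `P` plays no role. -/
lemma quadForm_add_le {P : Matrix (Fin n) (Fin n) ℝ} (hP : ∀ x, 0 ≤ quadForm P x) {s : ℝ}
    (hs : 0 < s) (x y : EuclideanSpace ℝ (Fin n)) :
    quadForm P (x + y) ≤ (1 + s) * quadForm P x + (1 + 1 / s) * quadForm P y := by
  have h := hP (s • x - y)
  rw [quadForm_smul_sub] at h
  rw [quadForm_add]
  set b := x.ofLp ⬝ᵥ (P *ᵥ y.ofLp) + y.ofLp ⬝ᵥ (P *ᵥ x.ofLp)
  have h2 : b ≤ s * quadForm P x + 1 / s * quadForm P y := by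
    have : b = (s * b) / s := by field_simp
    rw [this, div_le_iff₀ hs]
    have : (s * quadForm P x + 1 / s * quadForm P y) * s = s ^ 2 * quadForm P x + quadForm P y := by
      field_simp
    linarith
  linarith

lemma norm_mulE_le (M : Matrix (Fin n) (Fin m) ℝ) (x : EuclideanSpace ℝ (Fin m)) :
    ‖mulE M x‖ ≤ ‖M‖ * ‖x‖ :=
  l2_opNorm_mulVec M x

lemma quadForm_eq_inner (P : Matrix (Fin n) (Fin n) ℝ) (x : EuclideanSpace ℝ (Fin n)) :
    quadForm P x = inner ℝ (mulE P x) x := by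
  simp [quadForm, mulE, EuclideanSpace.inner_eq_star_dotProduct]

lemma abs_quadForm_le (P : Matrix (Fin n) (Fin n) ℝ) (x : EuclideanSpace ℝ (Fin n)) :
    |quadForm P x| ≤ ‖P‖ * ‖x‖ ^ 2 := by
  rw [quadForm_eq_inner]
  calc _ ≤ ‖mulE P x‖ * ‖x‖ := abs_real_inner_le_norm _ _
    _ ≤ (‖P‖ * ‖x‖) * ‖x‖ := by gcongr; exact norm_mulE_le P x
    _ = _ := by ring

lemma quadForm_le (P : Matrix (Fin n) (Fin n) ℝ) (x : EuclideanSpace ℝ (Fin n)) :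
    quadForm P x ≤ ‖P‖ * ‖x‖ ^ 2 :=
  (le_abs_self _).trans (abs_quadForm_le P x)

lemma mulE_add_matrix (M N : Matrix (Fin n) (Fin m) ℝ) (x : EuclideanSpace ℝ (Fin m)) :
    mulE (M + N) x = mulE M x + mulE N x := by
  simp [mulE, add_mulVec]

lemma mulE_sub_matrix (M N : Matrix (Fin n) (Fin m) ℝ) (x : EuclideanSpace ℝ (Fin m)) :
    mulE (M - N) x = mulE M x - mulE N x := by
  simp [mulE, sub_mulVec]

lemma mulE_mulE (M : Matrix (Fin n) (Fin m) ℝ) (N : Matrix (Fin m) (Fin l) ℝ)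
    (x : EuclideanSpace ℝ (Fin l)) : mulE M (mulE N x) = mulE (M * N) x := by
  simp [mulE, mulVec_mulVec]

lemma continuous_quadForm (P : Matrix (Fin n) (Fin n) ℝ) : Continuous (quadForm P) := by
  unfold quadForm
  fun_prop

lemma continuous_quadForm_matrix (x : EuclideanSpace ℝ (Fin n)) :
    Continuous fun P : Matrix (Fin n) (Fin n) ℝ => quadForm P x := by
  unfold quadForm
  fun_prop

lemma quadForm_smul (P : Matrix (Fin n) (Fin n) ℝ) (c : ℝ) (x : EuclideanSpace ℝ (Fin n)) :
    quadForm P (c • x) = c ^ 2 * quadForm P x := by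
  simp only [quadForm, WithLp.ofLp_smul, mulVec_smul, dotProduct_smul, smul_dotProduct, smul_eq_mul]
  ring

lemma quadForm_pos {P : Matrix (Fin n) (Fin n) ℝ} (hP : P.PosDef) {x : EuclideanSpace ℝ (Fin n)}
    (hx : x ≠ 0) : 0 < quadForm P x := by
  have h : x.ofLp ≠ 0 := by simpa using hx
  simpa [quadForm] using hP.dotProduct_mulVec_pos h

lemma exists_pos_mul_norm_sq_le {P : Matrix (Fin n) (Fin n) ℝ} (hP : P.PosDef) :
    ∃ q : ℝ, 0 < q ∧ ∀ x, q * ‖x‖ ^ 2 ≤ quadForm P x := by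
  -- The unit sphere is empty when `n = 0`; otherwise the constant is the minimum of the form on it.
  obtain hn | hn := (Metric.sphere (0 : EuclideanSpace ℝ (Fin n)) 1).eq_empty_or_nonempty
  · refine ⟨1, one_pos, fun x => ?_⟩
    obtain rfl | hx := eq_or_ne x 0
    · simp [quadForm]
    · have : (‖x‖⁻¹ • x) ∈ Metric.sphere (0 : EuclideanSpace ℝ (Fin n)) 1 := by
        simp [norm_smul, hx]
      simp [hn] at this
  · obtain ⟨z, hz, hmin⟩ := (isCompact_sphere (0 : EuclideanSpace ℝ (Fin n)) 1).exists_isMinOn hn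
      (continuous_quadForm P).continuousOn
    have hz0 : z ≠ 0 := by
      rintro rfl
      simp at hz
    refine ⟨quadForm P z, quadForm_pos hP hz0, fun x => ?_⟩
    obtain rfl | hx := eq_or_ne x 0
    · simp [quadForm]
    · have hmem : (‖x‖⁻¹ • x) ∈ Metric.sphere (0 : EuclideanSpace ℝ (Fin n)) 1 := by
        simp [norm_smul, hx]
      have h : quadForm P z ≤ quadForm P (‖x‖⁻¹ • x) := hmin hmem
      have hx' : 0 < ‖x‖ ^ 2 := by positivity
      rw [quadForm_smul, inv_pow, ← div_eq_inv_mul, le_div_iff₀ hx'] at h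
      exact h

lemma quadForm_nonneg {P : Matrix (Fin n) (Fin n) ℝ} (hP : P.PosDef)
    (x : EuclideanSpace ℝ (Fin n)) : 0 ≤ quadForm P x := by
  simpa [quadForm] using hP.posSemidef.dotProduct_mulVec_nonneg x.ofLp

lemma posDef_of_quadForm_pos {P : Matrix (Fin n) (Fin n) ℝ} (hP : Pᵀ = P)
    (h : ∀ x, x ≠ 0 → 0 < quadForm P x) : P.PosDef := by
  refine .of_dotProduct_mulVec_pos (by simpa [IsHermitian] using hP) fun x hx => ?_
  simpa [quadForm] using h (WithLp.toLp 2 x) (by simpa using hx)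

lemma posSemidef_of_quadForm_nonneg {P : Matrix (Fin n) (Fin n) ℝ} (hP : Pᵀ = P)
    (h : ∀ x, 0 ≤ quadForm P x) : P.PosSemidef := by
  refine .of_dotProduct_mulVec_nonneg (by simpa [IsHermitian] using hP) fun x => ?_
  simpa [quadForm] using h (WithLp.toLp 2 x)

lemma transpose_eq_of_posDef {P : Matrix (Fin n) (Fin n) ℝ} (hP : P.PosDef) : Pᵀ = P := by
  simpa [IsHermitian] using hP.isHermitian

/-- Polarization: the entries of a symmetric matrix in terms of its quadratic form. -/
lemma apply_eq_quadForm {P : Matrix (Fin n) (Fin n) ℝ} (hP : Pᵀ = P) (i j : Fin n) :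
    P i j = (quadForm P (EuclideanSpace.single i 1 + EuclideanSpace.single j 1)
      - quadForm P (EuclideanSpace.single i 1) - quadForm P (EuclideanSpace.single j 1)) / 2 := by
  have hji : P j i = P i j := congrFun (congrFun hP i) j
  rw [quadForm_add]
  simp only [PiLp.ofLp_single, mulVec_single_one, single_one_dotProduct, col_apply, hji]
  ring

lemma eq_of_quadForm_eq {P S : Matrix (Fin n) (Fin n) ℝ} (hP : Pᵀ = P) (hS : Sᵀ = S)
    (h : ∀ x, quadForm P x = quadForm S x) : P = S := by
  ext i j
  rw [apply_eq_quadForm hP, apply_eq_quadForm hS, h, h, h]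

end Basic

/-! ### The Bellman equation, the comparison principle and uniqueness. -/

section Riccati

variable {n m : ℕ}

/-- The right-hand side of the discrete-time algebraic Riccati equation. -/
def riccatiMap (A : Matrix (Fin n) (Fin n) ℝ) (B : Matrix (Fin n) (Fin m) ℝ)
    (Q : Matrix (Fin n) (Fin n) ℝ) (R : Matrix (Fin m) (Fin m) ℝ) (P : Matrix (Fin n) (Fin n) ℝ) :
    Matrix (Fin n) (Fin n) ℝ :=
  Aᵀ * P * A - Aᵀ * P * B * (R + Bᵀ * P * B)⁻¹ * Bᵀ * P * A + Q

/-- The feedback gain that is greedy with respect to the cost-to-go `xᵀ P x`. -/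
def greedyGain (A : Matrix (Fin n) (Fin n) ℝ) (B : Matrix (Fin n) (Fin m) ℝ)
    (R : Matrix (Fin m) (Fin m) ℝ) (P : Matrix (Fin n) (Fin n) ℝ) : Matrix (Fin m) (Fin n) ℝ :=
  -((R + Bᵀ * P * B)⁻¹ * Bᵀ * P * A)

variable {A : Matrix (Fin n) (Fin n) ℝ} {B : Matrix (Fin n) (Fin m) ℝ}
  {Q P : Matrix (Fin n) (Fin n) ℝ} {R : Matrix (Fin m) (Fin m) ℝ}

lemma posDef_add_transpose_mul_mul (hR : R.PosDef) (hP : P.PosSemidef) :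
    (R + Bᵀ * P * B).PosDef := by
  have := hP.conjTranspose_mul_mul_same B
  rw [conjTranspose_eq_transpose_of_trivial] at this
  exact hR.add_posSemidef this

lemma dotProduct_transpose_mul (M : Matrix (Fin n) (Fin m) ℝ) (v : Fin m → ℝ) (y : Fin n → ℝ) :
    v ⬝ᵥ (Mᵀ *ᵥ y) = (M *ᵥ v) ⬝ᵥ y := by
  rw [mulVec_transpose, dotProduct_comm, ← dotProduct_mulVec, dotProduct_comm]

/-- Completion of the square in the Bellman equation. -/
lemma bellman_eq (hR : R.PosDef) (hP : P.PosSemidef) (x : EuclideanSpace ℝ (Fin n))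
    (u : EuclideanSpace ℝ (Fin m)) :
    quadForm P (mulE A x + mulE B u) + quadForm Q x + quadForm R u
      = quadForm (riccatiMap A B Q R P) x
        + quadForm (R + Bᵀ * P * B) (u - mulE (greedyGain A B R P) x) := by
  have hG := posDef_add_transpose_mul_mul (B := B) hR hP
  have hPt : Pᵀ = P := by simpa [IsHermitian] using hP.isHermitian
  have hdet : IsUnit (R + Bᵀ * P * B).det := (isUnit_iff_isUnit_det _).1 hG.isUnit
  set G := R + Bᵀ * P * B with hGdef
  have hGt : Gᵀ = G := transpose_eq_of_posDef hG
  set a := P *ᵥ (A *ᵥ x.ofLp) with ha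
  set b := Bᵀ *ᵥ a with hb
  -- The minimizing input is `-k`; both sides reduce to the same terms in `a`, `b`, `k` and `u`.
  set k := G⁻¹ *ᵥ b with hk
  have hGk : G *ᵥ k = b := by simp [hk, mulVec_mulVec, mul_nonsing_inv _ hdet]
  have hRu : R = G - Bᵀ * P * B := by simp [hGdef]
  have h1 : (mulE (greedyGain A B R P) x).ofLp = -k := by
    simp only [mulE, greedyGain, ← hGdef, neg_mulVec, ← mulVec_mulVec, hk, hb, ha]
  have h2 : quadForm (riccatiMap A B Q R P) x
      = (A *ᵥ x.ofLp) ⬝ᵥ a - b ⬝ᵥ k + quadForm Q x := by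
    have e1 : (Aᵀ * P * B * G⁻¹ * Bᵀ * P * A) *ᵥ x.ofLp = Aᵀ *ᵥ (P *ᵥ (B *ᵥ k)) := by
      simp [hk, hb, ha, mulVec_mulVec, Matrix.mul_assoc]
    have e2 : (Aᵀ * P * A) *ᵥ x.ofLp = Aᵀ *ᵥ a := by
      simp [ha, mulVec_mulVec, Matrix.mul_assoc]
    have e3 : (A *ᵥ x.ofLp) ⬝ᵥ (P *ᵥ (B *ᵥ k)) = b ⬝ᵥ k := by
      rw [dotProduct_comm b k, hb, dotProduct_transpose_mul, ha]
      conv_lhs => rw [← hPt, dotProduct_transpose_mul, dotProduct_comm]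
    simp only [quadForm, riccatiMap, ← hGdef, add_mulVec, sub_mulVec, dotProduct_add,
      dotProduct_sub, e1, e2, dotProduct_transpose_mul, e3]
  have h3 : quadForm R u = u.ofLp ⬝ᵥ (G *ᵥ u.ofLp) - (B *ᵥ u.ofLp) ⬝ᵥ (P *ᵥ (B *ᵥ u.ofLp)) := by
    have : (Bᵀ * P * B) *ᵥ u.ofLp = Bᵀ *ᵥ (P *ᵥ (B *ᵥ u.ofLp)) := by
      simp [mulVec_mulVec, Matrix.mul_assoc]
    rw [quadForm, hRu, sub_mulVec, dotProduct_sub, this, dotProduct_transpose_mul]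
  have h4 : (A *ᵥ x.ofLp) ⬝ᵥ (P *ᵥ (B *ᵥ u.ofLp)) = (B *ᵥ u.ofLp) ⬝ᵥ a := by
    conv_lhs => rw [← hPt, dotProduct_transpose_mul, dotProduct_comm]
  have h5 : (B *ᵥ u.ofLp) ⬝ᵥ a = u.ofLp ⬝ᵥ b := by rw [hb, dotProduct_transpose_mul]
  have h6 : k ⬝ᵥ (G *ᵥ u.ofLp) = u.ofLp ⬝ᵥ b := by
    conv_lhs => rw [← hGt, dotProduct_transpose_mul, hGk, dotProduct_comm]
  rw [h2, h3]
  simp only [quadForm, mulE] at h1 ⊢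
  simp only [WithLp.ofLp_add, WithLp.ofLp_sub, h1, sub_neg_eq_add, mulVec_add, dotProduct_add,
    add_dotProduct, hGk, h4, h5, h6, ← ha]
  rw [dotProduct_comm k b]
  ring

/-- Any input bounds the minimum from above; `riccatiMap_eq` evaluates it at the minimizer. -/
lemma riccatiMap_le (hR : R.PosDef) (hP : P.PosSemidef) (x : EuclideanSpace ℝ (Fin n))
    (u : EuclideanSpace ℝ (Fin m)) :
    quadForm (riccatiMap A B Q R P) x
      ≤ quadForm P (mulE A x + mulE B u) + quadForm Q x + quadForm R u := by
  rw [bellman_eq hR hP]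
  linarith [quadForm_nonneg (posDef_add_transpose_mul_mul (B := B) hR hP)
    (u - mulE (greedyGain A B R P) x)]

lemma riccatiMap_eq (hR : R.PosDef) (hP : P.PosSemidef) (x : EuclideanSpace ℝ (Fin n)) :
    quadForm (riccatiMap A B Q R P) x
      = quadForm P (mulE A x + mulE B (mulE (greedyGain A B R P) x)) + quadForm Q x
        + quadForm R (mulE (greedyGain A B R P) x) := by
  rw [bellman_eq hR hP, sub_self]
  simp [quadForm]

lemma transpose_riccatiMap (hQ : Q.PosDef) (hR : R.PosDef) (hP : Pᵀ = P) :
    (riccatiMap A B Q R P)ᵀ = riccatiMap A B Q R P := by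
  simp [riccatiMap, transpose_nonsing_inv, hP, transpose_eq_of_posDef hQ,
    transpose_eq_of_posDef hR, Matrix.mul_assoc]

/-- A positive definite solution of the Riccati equation lies below every nonnegative
supersolution of the Bellman equation. -/
lemma quadForm_le_of_supersolution (hQ : Q.PosDef) (hR : R.PosDef)
    (hP : IsRiccatiSolution A B Q R P) {S : EuclideanSpace ℝ (Fin n) → ℝ} {c : ℝ}
    (hS0 : ∀ x, 0 ≤ S x) (hSc : ∀ x, S x ≤ c * ‖x‖ ^ 2)
    (hS : ∀ x, ∃ u, S (mulE A x + mulE B u) + quadForm Q x + quadForm R u ≤ S x)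
    (x : EuclideanSpace ℝ (Fin n)) : quadForm P x ≤ S x := by
  obtain ⟨q, hq, hqQ⟩ := exists_pos_mul_norm_sq_le hQ
  have hstep : ∀ x u, quadForm P x
      ≤ quadForm P (mulE A x + mulE B u) + quadForm Q x + quadForm R u := fun x u => by
    have h := riccatiMap_le (A := A) (B := B) (Q := Q) hR hP.1.posSemidef x u
    have e : riccatiMap A B Q R P = P := hP.2.symm
    rwa [e] at h
  obtain ⟨c', hc', hSc'⟩ : ∃ c', 0 < c' ∧ ∀ x, S x ≤ c' * ‖x‖ ^ 2 :=
    ⟨max c 1, by positivity, fun x => (hSc x).trans (by gcongr; exact le_max_left _ _)⟩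
  obtain ⟨ε, hε0, hε1, hεS⟩ : ∃ ε, 0 < ε ∧ ε < 1 ∧ ∀ x, ε * S x ≤ quadForm Q x := by
    -- The cap `1 / 2` only ensures `ε < 1`.
    refine ⟨min (q / c') (1 / 2), by positivity, (min_le_right _ _).trans_lt (by norm_num),
      fun x => ?_⟩
    calc min (q / c') (1 / 2) * S x ≤ (q / c') * (c' * ‖x‖ ^ 2) :=
          mul_le_mul (min_le_left _ _) (hSc' x) (hS0 x) (by positivity)
      _ = q * ‖x‖ ^ 2 := by field_simp
      _ ≤ _ := hqQ x
  set t : ℝ := ‖P‖ / q with ht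
  -- The excess factor contracts: if `P ≤ (1 + r) S` at the successor state, then at `x` the form is
  -- at most `(1 + r) S - r Q - r R`, and `Q ≥ ε S` lowers `r` to `r (1 - ε)`. The start `t` works
  -- because `S ≥ Q ≥ q ‖x‖ ^ 2`.
  have hiter : ∀ k : ℕ, ∀ x, quadForm P x ≤ (1 + t * (1 - ε) ^ k) * S x := by
    intro k
    induction k with
    | zero =>
      intro x
      obtain ⟨u, hu⟩ := hS x
      have h1 : q * ‖x‖ ^ 2 ≤ S x := by
        linarith [hqQ x, hS0 (mulE A x + mulE B u), quadForm_nonneg hR u]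
      calc quadForm P x ≤ ‖P‖ * ‖x‖ ^ 2 := quadForm_le P x
        _ = t * (q * ‖x‖ ^ 2) := by rw [ht]; field_simp
        _ ≤ t * S x := by gcongr
        _ ≤ _ := by
          have := hS0 x
          simp only [pow_zero, mul_one]
          nlinarith
    | succ k ih =>
      intro x
      obtain ⟨u, hu⟩ := hS x
      have h1 := hstep x u
      have h2 := ih (mulE A x + mulE B u)
      set r := t * (1 - ε) ^ k with hr
      have hr0 : 0 ≤ r := by
        have : 0 ≤ 1 - ε := by linarith
        positivity
      have h3 : (1 + r) * S (mulE A x + mulE B u)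
          ≤ (1 + r) * (S x - quadForm Q x - quadForm R u) := by
        gcongr
        linarith
      have h4 : r * (ε * S x) ≤ r * quadForm Q x := by gcongr; exact hεS x
      have h5 := mul_nonneg hr0 (quadForm_nonneg hR u)
      have h6 : t * (1 - ε) ^ (k + 1) = r * (1 - ε) := by rw [hr]; ring
      rw [h6]
      nlinarith
  have hlim : Tendsto (fun k : ℕ => (1 + t * (1 - ε) ^ k) * S x) atTop (𝓝 ((1 + t * 0) * S x)) :=
    (((tendsto_pow_atTop_nhds_zero_of_lt_one (by linarith) (by linarith)).const_mul t).const_add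
      1).mul_const _
  have := ge_of_tendsto' hlim fun k => hiter k x
  simpa using this

/-- Under its greedy gain each solution satisfies the Bellman equation, so it is a supersolution and
comparison applies in both directions. -/
lemma IsRiccatiSolution.eq {P' : Matrix (Fin n) (Fin n) ℝ} (hQ : Q.PosDef) (hR : R.PosDef)
    (hP : IsRiccatiSolution A B Q R P) (hP' : IsRiccatiSolution A B Q R P') : P = P' := by
  have key : ∀ {P P' : Matrix (Fin n) (Fin n) ℝ}, IsRiccatiSolution A B Q R P →
      IsRiccatiSolution A B Q R P' → ∀ x, quadForm P x ≤ quadForm P' x := by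
    intro P P' hP hP'
    refine quadForm_le_of_supersolution hQ hR hP (quadForm_nonneg hP'.1) (quadForm_le P')
      fun x => ⟨mulE (greedyGain A B R P') x, ?_⟩
    have e : riccatiMap A B Q R P' = P' := hP'.2.symm
    rw [← riccatiMap_eq hR hP'.1.posSemidef, e]
  exact eq_of_quadForm_eq (transpose_eq_of_posDef hP.1) (transpose_eq_of_posDef hP'.1)
    fun x => le_antisymm (key hP hP' x) (key hP' hP x)

end Riccati

/-! ### Square-summable decay of powers of Schur stable matrices. -/

section Schur

variable {n : ℕ}

/-- Gelfand's formula, with `r` strictly between the spectral radius and 1. -/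
lemma exists_pow_bound_of_spectralRadius_lt_one {E : Type*} [NormedRing E] [NormedAlgebra ℂ E]
    [CompleteSpace E] {a : E} (h : spectralRadius ℂ a < 1) :
    ∃ r : ℝ, 0 ≤ r ∧ r < 1 ∧ ∀ᶠ k : ℕ in atTop, ‖a ^ k‖ ≤ r ^ k := by
  obtain ⟨r, hr, hr1⟩ := ENNReal.lt_iff_exists_nnreal_btwn.1 h
  refine ⟨r, r.2, by exact_mod_cast hr1, ?_⟩
  have hlim := spectrum.pow_nnnorm_pow_one_div_tendsto_nhds_spectralRadius a
  filter_upwards [hlim.eventually_lt_const hr, eventually_gt_atTop 0] with k hk hk0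
  have hk' : (k : ℝ) ≠ 0 := by positivity
  have h1 : ((‖a ^ k‖₊ : ENNReal) ^ (1 / k : ℝ)) ^ (k : ℝ) ≤ (r : ENNReal) ^ (k : ℝ) :=
    ENNReal.rpow_le_rpow hk.le (by positivity)
  rw [← ENNReal.rpow_mul, one_div_mul_cancel hk', ENNReal.rpow_one, ENNReal.rpow_natCast] at h1
  exact_mod_cast h1

lemma IsSchur.spectralRadius_lt_one {M : Matrix (Fin n) (Fin n) ℝ} (hM : IsSchur M) :
    spectralRadius ℂ (M.map (algebraMap ℝ ℂ)) < 1 := by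
  obtain h | h := (spectrum ℂ (M.map (algebraMap ℝ ℂ))).eq_empty_or_nonempty
  · rw [spectralRadius, h]
    simp
  · exact_mod_cast spectrum.spectralRadius_lt_of_forall_lt_of_nonempty h (r := 1)
      fun z hz => by exact_mod_cast hM z hz

/-- Real vectors embed isometrically in complex ones, so the complex spectrum controls real
trajectories. -/
lemma norm_mulE_le_complexification (M : Matrix (Fin n) (Fin n) ℝ)
    (x : EuclideanSpace ℝ (Fin n)) :
    ‖mulE M x‖ ≤ ‖M.map (algebraMap ℝ ℂ)‖ * ‖x‖ := by
  have hnorm : ∀ v : Fin n → ℝ,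
      ‖(WithLp.toLp 2 ((algebraMap ℝ ℂ) ∘ v) : EuclideanSpace ℂ (Fin n))‖
        = ‖(WithLp.toLp 2 v : EuclideanSpace ℝ (Fin n))‖ := fun v => by
    simp [EuclideanSpace.norm_eq]
  have h := l2_opNorm_mulVec (M.map (algebraMap ℝ ℂ)) (WithLp.toLp 2 ((algebraMap ℝ ℂ) ∘ x.ofLp))
  have e : M.map (algebraMap ℝ ℂ) *ᵥ ((algebraMap ℝ ℂ) ∘ x.ofLp)
      = (algebraMap ℝ ℂ) ∘ (M *ᵥ x.ofLp) := by
    ext i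
    exact ((algebraMap ℝ ℂ).map_mulVec M x.ofLp i).symm
  simp only [e] at h
  rw [hnorm] at h
  exact (hnorm (M *ᵥ x.ofLp)).symm.le.trans h

lemma IsSchur.exists_summable_bound {M : Matrix (Fin n) (Fin n) ℝ} (hM : IsSchur M) :
    ∃ b : ℕ → ℝ, Summable b ∧ ∀ k x, ‖mulE (M ^ k) x‖ ^ 2 ≤ b k * ‖x‖ ^ 2 := by
  obtain ⟨r, hr0, hr1, hr⟩ := exists_pow_bound_of_spectralRadius_lt_one hM.spectralRadius_lt_one
  refine ⟨fun k => ‖(M.map (algebraMap ℝ ℂ)) ^ k‖ ^ 2, ?_, fun k x => ?_⟩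
  · refine Summable.of_norm_bounded_eventually_nat (summable_geometric_of_lt_one hr0 hr1) ?_
    filter_upwards [hr] with k hk
    have h1 : r ^ k ≤ 1 := pow_le_one₀ hr0 hr1.le
    have h0 : 0 ≤ r ^ k := by positivity
    rw [Real.norm_of_nonneg (by positivity), sq]
    calc _ ≤ r ^ k * r ^ k := by gcongr
      _ ≤ r ^ k := mul_le_of_le_one_right h0 h1
  · have h := norm_mulE_le_complexification (M ^ k) x
    have e : (M ^ k).map (algebraMap ℝ ℂ) = (M.map (algebraMap ℝ ℂ)) ^ k :=
      map_pow (algebraMap ℝ ℂ).mapMatrix M k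
    rw [e] at h
    calc _ ≤ (‖(M.map (algebraMap ℝ ℂ)) ^ k‖ * ‖x‖) ^ 2 := by gcongr
      _ = _ := by ring

end Schur

/-! ### Existence of the Riccati solution by value iteration. -/

section Existence

variable {n m : ℕ} {A : Matrix (Fin n) (Fin n) ℝ} {B : Matrix (Fin n) (Fin m) ℝ}
  {Q : Matrix (Fin n) (Fin n) ℝ} {R : Matrix (Fin m) (Fin m) ℝ}

lemma quadForm_mulE (K : Matrix (Fin m) (Fin n) ℝ) (R : Matrix (Fin m) (Fin m) ℝ)
    (x : EuclideanSpace ℝ (Fin n)) : quadForm R (mulE K x) = quadForm (Kᵀ * R * K) x := by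
  have : (Kᵀ * R * K) *ᵥ x.ofLp = Kᵀ *ᵥ (R *ᵥ (K *ᵥ x.ofLp)) := by
    simp [mulVec_mulVec, Matrix.mul_assoc]
  rw [quadForm, quadForm, this, dotProduct_transpose_mul, mulE]

/-- The infinite-horizon cost of a stabilizing feedback is a supersolution of the Bellman
equation. -/
lemma IsStabilizable.exists_supersolution (h : IsStabilizable A B) (hQ : Q.PosDef)
    (hR : R.PosDef) :
    ∃ S : EuclideanSpace ℝ (Fin n) → ℝ, (∀ x, 0 ≤ S x) ∧
      ∀ x, ∃ u, S (mulE A x + mulE B u) + quadForm Q x + quadForm R u ≤ S x := by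
  obtain ⟨K, hK⟩ := h
  obtain ⟨b, hb, hbK⟩ := hK.exists_summable_bound
  set M := A + B * K with hM
  set G := Q + Kᵀ * R * K with hG
  have hGx : ∀ x, quadForm G x = quadForm Q x + quadForm R (mulE K x) := fun x => by
    rw [hG, quadForm_add_matrix, quadForm_mulE]
  have hG0 : ∀ x, 0 ≤ quadForm G x := fun x => by
    rw [hGx]
    exact add_nonneg (quadForm_nonneg hQ x) (quadForm_nonneg hR _)
  have hsum : ∀ x, Summable fun k : ℕ => quadForm G (mulE (M ^ k) x) := fun x => by
    refine Summable.of_nonneg_of_le (fun k => hG0 _) (fun k => ?_)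
      ((hb.mul_right (‖x‖ ^ 2)).mul_left ‖G‖)
    exact (quadForm_le G _).trans (by gcongr; exact hbK k x)
  refine ⟨fun x => ∑' k : ℕ, quadForm G (mulE (M ^ k) x), fun x => tsum_nonneg fun k => hG0 _,
    fun x => ⟨mulE K x, ?_⟩⟩
  have e1 : mulE A x + mulE B (mulE K x) = mulE M x := by
    rw [mulE_mulE, hM, mulE_add_matrix]
  have e2 : ∀ k, mulE (M ^ k) (mulE M x) = mulE (M ^ (k + 1)) x := fun k => by
    rw [mulE_mulE, pow_succ]
  have e3 : mulE (M ^ 0) x = x := by simp [mulE]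
  simp only [e1, e2]
  rw [(hsum x).tsum_eq_zero_add, e3, hGx]
  exact le_of_eq (by ring)

lemma continuousAt_riccatiMap {P : Matrix (Fin n) (Fin n) ℝ} (hR : R.PosDef)
    (hP : P.PosSemidef) : ContinuousAt (riccatiMap A B Q R) P := by
  have hG := posDef_add_transpose_mul_mul (B := B) hR hP
  have hdet : (R + Bᵀ * P * B).det ≠ 0 := ((isUnit_iff_isUnit_det _).1 hG.isUnit).ne_zero
  have hinv : ContinuousAt (fun P : Matrix (Fin n) (Fin n) ℝ => (R + Bᵀ * P * B)⁻¹) P := by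
    refine ContinuousAt.comp (f := fun P : Matrix (Fin n) (Fin n) ℝ => R + Bᵀ * P * B)
      (g := Inv.inv) (continuousAt_matrix_inv _ ?_) (by fun_prop)
    rw [Ring.inverse_eq_inv']
    exact continuousAt_inv₀ hdet
  have hmul : Continuous fun N : Matrix (Fin n) (Fin n) ℝ × Matrix (Fin m) (Fin m) ℝ =>
      Aᵀ * N.1 * A - Aᵀ * N.1 * B * N.2 * Bᵀ * N.1 * A + Q := by fun_prop
  exact ContinuousAt.comp (f := fun P => (P, (R + Bᵀ * P * B)⁻¹)) hmul.continuousAt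
    (continuousAt_id.prodMk hinv)

/-- Value iteration from `0` converges to a positive definite solution of the Riccati equation. -/
lemma IsStabilizable.exists_isRiccatiSolution (h : IsStabilizable A B) (hQ : Q.PosDef)
    (hR : R.PosDef) : ∃ P, IsRiccatiSolution A B Q R P := by
  obtain ⟨S, hS0, hS⟩ := h.exists_supersolution hQ hR
  set F := riccatiMap A B Q R with hF
  set p : ℕ → Matrix (Fin n) (Fin n) ℝ := fun k => F^[k] 0 with hp
  have hp0 : p 0 = 0 := rfl
  have hps : ∀ k, p (k + 1) = F (p k) := fun k => Function.iterate_succ_apply' F k 0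
  have hsymm : ∀ k, (p k)ᵀ = p k := by
    intro k
    induction k with
    | zero => simp [hp0]
    | succ k ih => rw [hps]; exact transpose_riccatiMap hQ hR ih
  have hFQ : ∀ {P : Matrix (Fin n) (Fin n) ℝ}, P.PosSemidef → ∀ x,
      quadForm Q x ≤ quadForm (F P) x := by
    intro P hP x
    have hP0 : ∀ y, 0 ≤ quadForm P y := fun y => by
      simpa [quadForm] using hP.dotProduct_mulVec_nonneg y.ofLp
    rw [hF, riccatiMap_eq hR hP]
    linarith [hP0 (mulE A x + mulE B (mulE (greedyGain A B R P) x)),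
      quadForm_nonneg hR (mulE (greedyGain A B R P) x)]
  have hpsd : ∀ k, (p k).PosSemidef := by
    intro k
    induction k with
    | zero => rw [hp0]; exact .zero
    | succ k ih =>
      refine posSemidef_of_quadForm_nonneg (hsymm _) fun x => ?_
      rw [hps]
      exact (quadForm_nonneg hQ x).trans (hFQ ih x)
  have hle : ∀ k x, quadForm (p k) x ≤ S x := by
    intro k
    induction k with
    | zero => intro x; rw [hp0, quadForm_zero_matrix]; exact hS0 x
    | succ k ih =>
      intro x
      obtain ⟨u, hu⟩ := hS x
      rw [hps]
      exact (riccatiMap_le hR (hpsd k) x u).trans (by linarith [ih (mulE A x + mulE B u)])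
  have hmono : ∀ x, Monotone fun k => quadForm (p k) x := by
    have : ∀ k x, quadForm (p k) x ≤ quadForm (p (k + 1)) x := by
      intro k
      induction k with
      | zero =>
        intro x
        rw [hp0, quadForm_zero_matrix, hps]
        exact (quadForm_nonneg hQ x).trans (hFQ (hpsd 0) x)
      | succ k ih =>
        intro x
        -- The gain greedy for `p (k + 1)` is merely admissible for `p k`, so the induction
        -- hypothesis compares the two costs under the same input.
        rw [hps (k + 1), hF, riccatiMap_eq hR (hpsd (k + 1))]
        rw [hps k]
        refine (riccatiMap_le hR (hpsd k) x (mulE (greedyGain A B R (p (k + 1))) x)).trans ?_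
        rw [← hps k]
        gcongr
        exact ih _
    exact fun x => monotone_nat_of_le_succ fun k => this k x
  have hconv : ∀ x, ∃ l, Tendsto (fun k => quadForm (p k) x) atTop (𝓝 l) := fun x =>
    ⟨_, tendsto_atTop_ciSup (hmono x) ⟨S x, by rintro _ ⟨k, rfl⟩; exact hle k x⟩⟩
  choose l hl using hconv
  -- The forms converge pointwise, being monotone and bounded by `S`; polarization transfers this to
  -- the entries.
  obtain ⟨P, hP⟩ : ∃ P, Tendsto p atTop (𝓝 P) := by
    refine ⟨Matrix.of fun i j => (l (EuclideanSpace.single i 1 + EuclideanSpace.single j 1)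
      - l (EuclideanSpace.single i 1) - l (EuclideanSpace.single j 1)) / 2, ?_⟩
    refine tendsto_pi_nhds.2 fun i => tendsto_pi_nhds.2 fun j => ?_
    simp only [fun k => apply_eq_quadForm (hsymm k) i j]
    exact (((hl _).sub (hl _)).sub (hl _)).div_const 2
  have hPlim : ∀ x, Tendsto (fun k => quadForm (p k) x) atTop (𝓝 (quadForm P x)) := fun x =>
    ((continuous_quadForm_matrix x).tendsto P).comp hP
  have hPt : Pᵀ = P := by
    refine tendsto_nhds_unique (f := fun k => (p k)ᵀ) (l := atTop) ?_ ?_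
    · exact ((continuous_id.matrix_transpose).tendsto P).comp hP
    · simpa only [hsymm] using hP
  have hPpsd : P.PosSemidef := posSemidef_of_quadForm_nonneg hPt fun x =>
    ge_of_tendsto' (hPlim x) fun k => by
      simpa [quadForm] using (hpsd k).dotProduct_mulVec_nonneg x.ofLp
  have hfix : P = F P := by
    refine tendsto_nhds_unique (f := fun k => p (k + 1)) ((tendsto_add_atTop_iff_nat 1).2 hP) ?_
    simp only [hps]
    exact (continuousAt_riccatiMap hR hPpsd).tendsto.comp hP
  refine ⟨P, posDef_of_quadForm_pos hPt fun x hx => ?_, hfix⟩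
  rw [hfix]
  exact (quadForm_pos hQ hx).trans_le (hFQ hPpsd x)

lemma IsStabilizable.existsUnique_isRiccatiSolution (h : IsStabilizable A B) (hQ : Q.PosDef)
    (hR : R.PosDef) : ∃! P, IsRiccatiSolution A B Q R P := by
  obtain ⟨P, hP⟩ := h.exists_isRiccatiSolution hQ hR
  exact ⟨P, hP, fun P' hP' => hP'.eq hQ hR hP⟩

lemma IsStabilizable.isRiccatiSolution_riccatiP (h : IsStabilizable A B) (hQ : Q.PosDef)
    (hR : R.PosDef) : IsRiccatiSolution A B Q R (riccatiP A B Q R) := by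
  have h' := h.exists_isRiccatiSolution hQ hR
  rw [riccatiP, dif_pos h']
  exact h'.choose_spec

/-- The Bellman equation along the optimal feedback. -/
lemma quadForm_riccatiP_eq (h : IsStabilizable A B) (hQ : Q.PosDef) (hR : R.PosDef)
    (x : EuclideanSpace ℝ (Fin n)) :
    quadForm (riccatiP A B Q R) x
      = quadForm (riccatiP A B Q R) (mulE A x + mulE B (mulE (lqrGain A B Q R) x)) + quadForm Q x
        + quadForm R (mulE (lqrGain A B Q R) x) := by
  have hP := h.isRiccatiSolution_riccatiP hQ hR
  have h1 := riccatiMap_eq (A := A) (B := B) (Q := Q) hR hP.1.posSemidef x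
  have e : riccatiMap A B Q R (riccatiP A B Q R) = riccatiP A B Q R := hP.2.symm
  rw [e] at h1
  exact h1

end Existence

/-! ### Comparison of the optimal costs of two nearby systems. -/

section Perturbation

variable {n m : ℕ} {A A' : Matrix (Fin n) (Fin n) ℝ} {B B' : Matrix (Fin n) (Fin m) ℝ}
  {Q : Matrix (Fin n) (Fin n) ℝ} {R : Matrix (Fin m) (Fin m) ℝ}

/-- If the optimal closed loops of two systems are `η`-close, then a slight inflation of the
optimal cost of the first bounds the optimal cost of the second. -/
lemma quadForm_riccatiP_le_of_closedLoop_near (h : IsStabilizable A B) (h' : IsStabilizable A' B')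
    (hQ : Q.PosDef) (hR : R.PosDef) {q M η : ℝ} (hq : 0 < q)
    (hqQ : ∀ x, q * ‖x‖ ^ 2 ≤ quadForm Q x) (hM : 0 ≤ M)
    (hPM : ∀ x, quadForm (riccatiP A B Q R) x ≤ M * ‖x‖ ^ 2)
    (hη0 : 0 < η) (hη1 : η ≤ 1) (hηq : 6 * M * η ≤ q)
    (hη : ∀ x, ‖mulE (A' - A) x + mulE (B' - B) (mulE (lqrGain A B Q R) x)‖ ≤ η * ‖x‖)
    (x : EuclideanSpace ℝ (Fin n)) :
    quadForm (riccatiP A' B' Q R) x ≤ (1 + 6 * M * η / q) * quadForm (riccatiP A B Q R) x := by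
  set P := riccatiP A B Q R with hPdef
  have hP := h.isRiccatiSolution_riccatiP hQ hR
  have hP0 : ∀ x, 0 ≤ quadForm P x := quadForm_nonneg hP.1
  -- Chosen so that the surplus `δ Q` pays for the perturbation `2 * (3 * M * η * ‖x‖ ^ 2)`; the
  -- factor 2 bounds `1 + δ`.
  set δ := 6 * M * η / q with hδ
  have hδ0 : 0 ≤ δ := by positivity
  have hδ1 : δ ≤ 1 := (div_le_one hq).2 hηq
  have hδq : δ * q = 6 * M * η := by rw [hδ]; field_simp
  refine quadForm_le_of_supersolution hQ hR (h'.isRiccatiSolution_riccatiP hQ hR)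
    (S := fun x => (1 + δ) * quadForm P x) (c := (1 + δ) * ‖P‖)
    (fun x => mul_nonneg (by linarith) (hP0 x)) (fun x => ?_) (fun x => ?_) x
  · rw [mul_assoc]
    exact mul_le_mul_of_nonneg_left (quadForm_le P x) (by linarith)
  · set u := mulE (lqrGain A B Q R) x with hu
    refine ⟨u, ?_⟩
    set y := mulE A x + mulE B u with hy
    set d := mulE (A' - A) x + mulE (B' - B) u with hd
    have e : mulE A' x + mulE B' u = y + d := by
      rw [hy, hd, mulE_sub_matrix, mulE_sub_matrix]
      abel
    have hbell : quadForm P x = quadForm P y + quadForm Q x + quadForm R u :=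
      quadForm_riccatiP_eq h hQ hR x
    have hN : 0 ≤ ‖x‖ ^ 2 := by positivity
    have hRu := quadForm_nonneg hR u
    have hyM : quadForm P y ≤ M * ‖x‖ ^ 2 := by
      linarith [hPM x, quadForm_nonneg hQ x]
    have hdM : quadForm P d ≤ M * (η ^ 2 * ‖x‖ ^ 2) := by
      refine (hPM d).trans ?_
      rw [← mul_pow]
      gcongr
      exact hη x
    -- Young's inequality with weight `η` keeps the error linear in `η`, since `quadForm P d` is of
    -- order `η ^ 2`.
    have h1 : quadForm P (y + d) ≤ quadForm P y + 3 * M * η * ‖x‖ ^ 2 := by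
      calc _ ≤ (1 + η) * quadForm P y + (1 + 1 / η) * quadForm P d := quadForm_add_le hP0 hη0 y d
        _ ≤ (quadForm P y + η * (M * ‖x‖ ^ 2)) + (1 + 1 / η) * (M * (η ^ 2 * ‖x‖ ^ 2)) := by
          have := mul_le_mul_of_nonneg_left hyM hη0.le
          have := mul_le_mul_of_nonneg_left hdM (show 0 ≤ 1 + 1 / η by positivity)
          linarith
        _ = quadForm P y + (2 + η) * (M * η * ‖x‖ ^ 2) := by field_simp; ring
        _ ≤ quadForm P y + 3 * (M * η * ‖x‖ ^ 2) := by
          gcongr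
          linarith
        _ = _ := by ring
    have h2 : (1 + δ) * quadForm P (y + d)
        ≤ (1 + δ) * (quadForm P y + 3 * M * η * ‖x‖ ^ 2) := by gcongr
    have h3 : (1 + δ) * (3 * M * η * ‖x‖ ^ 2) ≤ 2 * (3 * M * η * ‖x‖ ^ 2) := by
      gcongr
      linarith
    have h4 : 2 * (3 * M * η * ‖x‖ ^ 2) ≤ δ * quadForm Q x := by
      calc 2 * (3 * M * η * ‖x‖ ^ 2) = δ * (q * ‖x‖ ^ 2) := by linear_combination -‖x‖ ^ 2 * hδq
        _ ≤ _ := by gcongr; exact hqQ x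
    have h5 : 0 ≤ δ * quadForm R u := by positivity
    simp only [e]
    rw [hbell]
    linarith

/-- The closed loop and the gain are controlled by the optimal cost. -/
lemma norm_closedLoop_le_and_norm_lqrGain_le (h : IsStabilizable A B) (hQ : Q.PosDef) (hR : R.PosDef) {q r M : ℝ}
    (hq : 0 < q) (hqQ : ∀ x, q * ‖x‖ ^ 2 ≤ quadForm Q x)
    (hr : 0 < r) (hrR : ∀ u, r * ‖u‖ ^ 2 ≤ quadForm R u)
    (hPM : ∀ x, quadForm (riccatiP A B Q R) x ≤ M * ‖x‖ ^ 2) (x : EuclideanSpace ℝ (Fin n)) :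
    ‖mulE A x + mulE B (mulE (lqrGain A B Q R) x)‖ ≤ √(M / q) * ‖x‖ ∧
      ‖mulE (lqrGain A B Q R) x‖ ≤ √(M / r) * ‖x‖ := by
  have hP := h.isRiccatiSolution_riccatiP hQ hR
  have hbell := quadForm_riccatiP_eq h hQ hR
  have hPQ : ∀ x, q * ‖x‖ ^ 2 ≤ quadForm (riccatiP A B Q R) x := fun x => by
    rw [hbell]
    linarith [hqQ x, quadForm_nonneg hR (mulE (lqrGain A B Q R) x),
      quadForm_nonneg hP.1 (mulE A x + mulE B (mulE (lqrGain A B Q R) x))]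
  have key : ∀ {k : ℕ} {c : ℝ} (z : EuclideanSpace ℝ (Fin k)), 0 < c →
      c * ‖z‖ ^ 2 ≤ M * ‖x‖ ^ 2 → ‖z‖ ≤ √(M / c) * ‖x‖ := by
    intro k c z hc hz
    have h1 : ‖z‖ ^ 2 ≤ M / c * ‖x‖ ^ 2 := by
      rw [div_mul_eq_mul_div, le_div_iff₀ hc]
      linarith
    have h2 := Real.sqrt_le_sqrt h1
    rwa [Real.sqrt_sq (norm_nonneg _), Real.sqrt_mul' _ (by positivity),
      Real.sqrt_sq (norm_nonneg _)] at h2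
  have h1 := hbell x
  have h2 := hPM x
  have hQ0 := quadForm_nonneg hQ x
  have hR0 := quadForm_nonneg hR (mulE (lqrGain A B Q R) x)
  have hP0 := quadForm_nonneg hP.1 (mulE A x + mulE B (mulE (lqrGain A B Q R) x))
  -- In the Bellman equation every term is nonnegative, so `M ‖x‖ ^ 2` dominates both the successor
  -- cost, which is at least `q` times its squared norm, and the input cost.
  exact ⟨key _ hq (by linarith [hPQ (mulE A x + mulE B (mulE (lqrGain A B Q R) x))]),
    key _ hr (by linarith [hrR (mulE (lqrGain A B Q R) x)])⟩

end Perturbation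

/-! ### Uniform bounds over the parameter set and the one-step decrease. -/

section Uniform

lemma exists_norm_sub_le_of_affine {E F : Type*} [NormedAddCommGroup E] [NormedSpace ℝ E]
    [FiniteDimensional ℝ E] [NormedAddCommGroup F] [NormedSpace ℝ F] (f : E →ᵃ[ℝ] F) :
    ∃ a : ℝ, 0 ≤ a ∧ ∀ x y, ‖f y - f x‖ ≤ a * ‖y - x‖ := by
  refine ⟨‖f.linear.toContinuousLinearMap‖, norm_nonneg _, fun x y => ?_⟩
  have := f.linear.toContinuousLinearMap.le_opNorm (y - x)
  rwa [LinearMap.coe_toContinuousLinearMap', ← vsub_eq_sub y x, f.linearMap_vsub] at this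

variable {n m p : ℕ}
  {A : EuclideanSpace ℝ (Fin p) →ᵃ[ℝ] Matrix (Fin n) (Fin n) ℝ}
  {B : EuclideanSpace ℝ (Fin p) →ᵃ[ℝ] Matrix (Fin n) (Fin m) ℝ}
  {Q : Matrix (Fin n) (Fin n) ℝ} {R : Matrix (Fin m) (Fin m) ℝ}
  {Θ : Set (EuclideanSpace ℝ (Fin p))}

/-- For a gain of norm at most `κ`, the closed loop depends on the parameter in a Lipschitz way. -/
lemma exists_closedLoop_lipschitz (A : EuclideanSpace ℝ (Fin p) →ᵃ[ℝ] Matrix (Fin n) (Fin n) ℝ)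
    (B : EuclideanSpace ℝ (Fin p) →ᵃ[ℝ] Matrix (Fin n) (Fin m) ℝ) (κ : ℝ) (hκ : 0 ≤ κ) :
    ∃ l : ℝ, 0 < l ∧ ∀ θ θ' x u, ‖u‖ ≤ κ * ‖x‖ →
      ‖mulE (A θ' - A θ) x + mulE (B θ' - B θ) u‖ ≤ l * ‖θ' - θ‖ * ‖x‖ := by
  obtain ⟨a, ha, hA⟩ := exists_norm_sub_le_of_affine A
  obtain ⟨b, hb, hB⟩ := exists_norm_sub_le_of_affine B
  -- The `+ 1` only makes the constant positive.
  refine ⟨a + b * κ + 1, by positivity, fun θ θ' x u hu => ?_⟩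
  calc _ ≤ ‖mulE (A θ' - A θ) x‖ + ‖mulE (B θ' - B θ) u‖ := norm_add_le _ _
    _ ≤ ‖A θ' - A θ‖ * ‖x‖ + ‖B θ' - B θ‖ * ‖u‖ := add_le_add (norm_mulE_le _ _) (norm_mulE_le _ _)
    _ ≤ (a * ‖θ' - θ‖) * ‖x‖ + (b * ‖θ' - θ‖) * (κ * ‖x‖) := by
      gcongr
      · exact hA θ θ'
      · exact hB θ θ'
    _ ≤ _ := by nlinarith [mul_nonneg (norm_nonneg (θ' - θ)) (norm_nonneg x)]

/-- The optimal cost is bounded on compact parameter sets. -/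
lemma exists_riccatiP_bound (hQ : Q.PosDef) (hR : R.PosDef) (hΘ : IsCompact Θ)
    (hstab : ∀ θ ∈ Θ, IsStabilizable (A θ) (B θ)) :
    ∃ M : ℝ, 0 < M ∧ ∀ θ ∈ Θ, ∀ x, quadForm (riccatiP (A θ) (B θ) Q R) x ≤ M * ‖x‖ ^ 2 := by
  obtain ⟨q, hq, hqQ⟩ := exists_pos_mul_norm_sq_le hQ
  refine hΘ.induction_on (p := fun s => ∃ M : ℝ, 0 < M ∧ ∀ θ ∈ s, ∀ x,
    quadForm (riccatiP (A θ) (B θ) Q R) x ≤ M * ‖x‖ ^ 2) ⟨1, one_pos, by simp⟩ ?_ ?_ ?_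
  · rintro s t hst ⟨M, hM0, hM⟩
    exact ⟨M, hM0, fun θ hθ => hM θ (hst hθ)⟩
  · rintro s t ⟨M, hM0, hM⟩ ⟨N, hN0, hN⟩
    refine ⟨M + N, by positivity, ?_⟩
    rintro θ (hθ | hθ) x
    · exact (hM θ hθ x).trans (by gcongr; linarith)
    · exact (hN θ hθ x).trans (by gcongr; linarith)
  · intro θ hθ
    obtain ⟨M, hM0, hM⟩ : ∃ M : ℝ, 0 < M ∧ ∀ x,
        quadForm (riccatiP (A θ) (B θ) Q R) x ≤ M * ‖x‖ ^ 2 :=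
      ⟨‖riccatiP (A θ) (B θ) Q R‖ + 1, by positivity,
        fun x => (quadForm_le _ x).trans (by gcongr; linarith)⟩
    -- Only the gain at the centre `θ` enters, so no uniform gain bound is needed yet.
    obtain ⟨l, hl, hlip⟩ :=
      exists_closedLoop_lipschitz A B ‖lqrGain (A θ) (B θ) Q R‖ (norm_nonneg _)
    obtain ⟨η, hη0, hη1, hηq⟩ : ∃ η : ℝ, 0 < η ∧ η ≤ 1 ∧ 6 * M * η ≤ q := by
      refine ⟨min 1 (q / (6 * M)), by positivity, min_le_left _ _, ?_⟩
      calc 6 * M * min 1 (q / (6 * M)) ≤ 6 * M * (q / (6 * M)) := by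
            gcongr; exact min_le_right _ _
        _ = q := by field_simp
    refine ⟨Metric.ball θ (η / l) ∩ Θ, ?_, (1 + 6 * M * η / q) * M, by positivity, ?_⟩
    · exact inter_mem (mem_nhdsWithin_of_mem_nhds (Metric.ball_mem_nhds _ (by positivity)))
        self_mem_nhdsWithin
    · rintro θ' ⟨hθ', hθ'Θ⟩ x
      have hd : l * ‖θ' - θ‖ ≤ η := by
        rw [Metric.mem_ball, dist_eq_norm, lt_div_iff₀ hl] at hθ'
        linarith
      refine (quadForm_riccatiP_le_of_closedLoop_near (hstab θ hθ) (hstab θ' hθ'Θ) hQ hR hq hqQ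
        hM0.le hM hη0 hη1 hηq (fun x => (hlip θ θ' x _ (norm_mulE_le _ x)).trans ?_) x).trans ?_
      · gcongr
      · rw [mul_assoc (1 + 6 * M * η / q)]
        exact mul_le_mul_of_nonneg_left (hM x) (by positivity)

/-- The optimal cost is Lipschitz in the parameter on compact parameter sets. -/
lemma exists_riccatiP_lipschitz (hQ : Q.PosDef) (hR : R.PosDef)
    (hstab : ∀ θ ∈ Θ, IsStabilizable (A θ) (B θ)) {M : ℝ} (hM0 : 0 < M)
    (hM : ∀ θ ∈ Θ, ∀ x, quadForm (riccatiP (A θ) (B θ) Q R) x ≤ M * ‖x‖ ^ 2) :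
    ∃ L : ℝ, 0 < L ∧ ∀ θ ∈ Θ, ∀ θ' ∈ Θ, ∀ x, quadForm (riccatiP (A θ') (B θ') Q R) x
      ≤ quadForm (riccatiP (A θ) (B θ) Q R) x + L * ‖θ' - θ‖ * ‖x‖ ^ 2 := by
  obtain ⟨q, hq, hqQ⟩ := exists_pos_mul_norm_sq_le hQ
  obtain ⟨r, hr, hrR⟩ := exists_pos_mul_norm_sq_le hR
  obtain ⟨l, hl, hlip⟩ := exists_closedLoop_lipschitz A B (√(M / r)) (Real.sqrt_nonneg _)
  obtain ⟨η, hη0, hη1, hηq⟩ : ∃ η : ℝ, 0 < η ∧ η ≤ 1 ∧ 6 * M * η ≤ q := by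
    refine ⟨min 1 (q / (6 * M)), by positivity, min_le_left _ _, ?_⟩
    calc 6 * M * min 1 (q / (6 * M)) ≤ 6 * M * (q / (6 * M)) := by
          gcongr; exact min_le_right _ _
      _ = q := by field_simp
  -- The first summand serves parameters with `l * ‖θ' - θ‖ ≤ η`, the second the remaining ones,
  -- where the crude bound `M` suffices.
  refine ⟨6 * M * l / q * M + M * l / η, by positivity, fun θ hθ θ' hθ' x => ?_⟩
  have hP0 := quadForm_nonneg ((hstab θ hθ).isRiccatiSolution_riccatiP hQ hR).1 x
  have hMx := hM θ hθ x
  have e : (6 * M * l / q * M + M * l / η) * ‖θ' - θ‖ * ‖x‖ ^ 2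
      = 6 * M * (l * ‖θ' - θ‖) / q * (M * ‖x‖ ^ 2) + (l * ‖θ' - θ‖) / η * (M * ‖x‖ ^ 2) := by
    field_simp
  rw [e]
  -- The perturbation lemma is applied with `l * ‖θ' - θ‖` as its `η`, which must be positive.
  obtain rfl | hne := eq_or_ne θ' θ
  · simp
  have hd0 : 0 < l * ‖θ' - θ‖ := mul_pos hl (norm_pos_iff.2 (sub_ne_zero.2 hne))
  obtain hd | hd := le_or_gt (l * ‖θ' - θ‖) η
  · have h1 := quadForm_riccatiP_le_of_closedLoop_near (hstab θ hθ) (hstab θ' hθ') hQ hR hq hqQ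
      hM0.le (hM θ hθ) hd0 (hd.trans hη1) (le_trans (by gcongr) hηq)
      (fun x => hlip θ θ' x _
        (norm_closedLoop_le_and_norm_lqrGain_le (hstab θ hθ) hQ hR hq hqQ hr hrR (hM θ hθ) x).2) x
    have h2 : 6 * M * (l * ‖θ' - θ‖) / q * quadForm (riccatiP (A θ) (B θ) Q R) x
        ≤ 6 * M * (l * ‖θ' - θ‖) / q * (M * ‖x‖ ^ 2) := by gcongr
    have h3 : 0 ≤ (l * ‖θ' - θ‖) / η * (M * ‖x‖ ^ 2) := by positivity
    linarith
  · have h1 : 1 ≤ (l * ‖θ' - θ‖) / η := (one_le_div hη0).2 hd.le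
    have h2 : 1 * (M * ‖x‖ ^ 2) ≤ (l * ‖θ' - θ‖) / η * (M * ‖x‖ ^ 2) := by gcongr
    have h3 : 0 ≤ 6 * M * (l * ‖θ' - θ‖) / q * (M * ‖x‖ ^ 2) := by positivity
    linarith [hM θ' hθ' x]

/-- One step of the adaptive closed loop: the optimal cost decreases up to the squared
discrepancy `d` between the next state and its nominal prediction. -/
lemma quadForm_riccatiP_step_le (hQ : Q.PosDef) (hR : R.PosDef)
    (hstab : ∀ θ ∈ Θ, IsStabilizable (A θ) (B θ)) {q r M L X μ : ℝ}
    (hq : 0 < q) (hqQ : ∀ x, q * ‖x‖ ^ 2 ≤ quadForm Q x)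
    (hr : 0 < r) (hrR : ∀ u, r * ‖u‖ ^ 2 ≤ quadForm R u) (hM0 : 0 < M)
    (hM : ∀ θ ∈ Θ, ∀ x, quadForm (riccatiP (A θ) (B θ) Q R) x ≤ M * ‖x‖ ^ 2) (hL0 : 0 < L)
    (hL : ∀ θ ∈ Θ, ∀ θ' ∈ Θ, ∀ x, quadForm (riccatiP (A θ') (B θ') Q R) x
      ≤ quadForm (riccatiP (A θ) (B θ) Q R) x + L * ‖θ' - θ‖ * ‖x‖ ^ 2) (hμ : 0 < μ)
    {θ θ' : EuclideanSpace ℝ (Fin p)} (hθ : θ ∈ Θ) (hθ' : θ' ∈ Θ)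
    {x z d : EuclideanSpace ℝ (Fin n)}
    (hz : z = mulE (A θ) x + mulE (B θ) (mulE (lqrGain (A θ) (B θ) Q R) x) + d)
    (hzX : ‖z‖ ≤ X) (hd : ‖θ' - θ‖ ≤ √μ * ‖d‖) :
    quadForm (riccatiP (A θ') (B θ') Q R) z - quadForm (riccatiP (A θ) (B θ) Q R) x
      ≤ -(q / 2) * ‖x‖ ^ 2 + ((L ^ 2 * (M / q) / q + L / 2) * (X ^ 2 * μ) + L / 2
        + (1 + 4 * M / q) * M) * ‖d‖ ^ 2 := by
  set P := riccatiP (A θ) (B θ) Q R with hPdef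
  set y := mulE (A θ) x + mulE (B θ) (mulE (lqrGain (A θ) (B θ) Q R) x) with hy
  have hX : 0 ≤ X := (norm_nonneg _).trans hzX
  have hP0 : ∀ x, 0 ≤ quadForm P x :=
    quadForm_nonneg ((hstab θ hθ).isRiccatiSolution_riccatiP hQ hR).1
  have hbell : quadForm P x = quadForm P y + quadForm Q x
      + quadForm R (mulE (lqrGain (A θ) (B θ) Q R) x) := quadForm_riccatiP_eq (hstab θ hθ) hQ hR x
  have hyP : quadForm P y ≤ quadForm P x - q * ‖x‖ ^ 2 := by
    linarith [hqQ x, quadForm_nonneg hR (mulE (lqrGain (A θ) (B θ) Q R) x)]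
  have hyM : quadForm P y ≤ M * ‖x‖ ^ 2 := by
    have : 0 ≤ q * ‖x‖ ^ 2 := by positivity
    linarith [hM θ hθ x]
  set κ := √(M / q) with hκ
  have hκ2 : κ ^ 2 = M / q := Real.sq_sqrt (by positivity)
  have hyκ : ‖y‖ ≤ κ * ‖x‖ :=
    (norm_closedLoop_le_and_norm_lqrGain_le (hstab θ hθ) hQ hR hq hqQ hr hrR (hM θ hθ) x).1
  have hzn : ‖z‖ ≤ κ * ‖x‖ + ‖d‖ := by
    rw [hz]
    exact (norm_add_le _ _).trans (by linarith)
  have h1 : quadForm P z ≤ quadForm P x - 3 / 4 * (q * ‖x‖ ^ 2)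
      + (1 + 4 * M / q) * M * ‖d‖ ^ 2 := by
    -- This Young weight spends exactly a quarter of `q * ‖x‖ ^ 2`; the parameter update spends
    -- another quarter, leaving `q / 2`.
    have hs : 0 < q / (4 * M) := by positivity
    have e1 := quadForm_add_le hP0 hs y d
    have e2 : q / (4 * M) * quadForm P y ≤ q / (4 * M) * (M * ‖x‖ ^ 2) := by gcongr
    have e3 : q / (4 * M) * (M * ‖x‖ ^ 2) = 1 / 4 * (q * ‖x‖ ^ 2) := by field_simp
    have e4 : (1 + 1 / (q / (4 * M))) * quadForm P d ≤ (1 + 4 * M / q) * (M * ‖d‖ ^ 2) := by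
      rw [one_div_div]
      gcongr
      exact hM θ hθ d
    rw [hz]
    linarith
  have h2 : L * ‖θ' - θ‖ * ‖z‖ ^ 2 ≤ q / 4 * ‖x‖ ^ 2
      + ((L ^ 2 * (M / q) / q + L / 2) * (X ^ 2 * μ) + L / 2) * ‖d‖ ^ 2 := by
    have hμ2 : √μ ^ 2 = μ := Real.sq_sqrt hμ.le
    have hμ0 : 0 ≤ √μ := Real.sqrt_nonneg μ
    have hκ0 : 0 ≤ κ := Real.sqrt_nonneg _
    -- Only one factor `‖z‖` is replaced by `X`; the other must keep `‖x‖` so that the square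
    -- completed in `e2` can absorb it.
    have e1 : L * ‖θ' - θ‖ * ‖z‖ ^ 2 ≤ L * (√μ * ‖d‖) * (X * (κ * ‖x‖ + ‖d‖)) := by
      rw [sq]
      gcongr
    have e2 : L * √μ * X * κ * ‖d‖ * ‖x‖
        ≤ q / 4 * ‖x‖ ^ 2 + L ^ 2 * κ ^ 2 / q * (X ^ 2 * √μ ^ 2) * ‖d‖ ^ 2 := by
      have h : 0 ≤ q * (‖x‖ / 2 - L * √μ * X * κ * ‖d‖ / q) ^ 2 := by positivity
      have h' : q * (‖x‖ / 2 - L * √μ * X * κ * ‖d‖ / q) ^ 2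
          = q / 4 * ‖x‖ ^ 2 + L ^ 2 * κ ^ 2 / q * (X ^ 2 * √μ ^ 2) * ‖d‖ ^ 2
            - L * √μ * X * κ * ‖d‖ * ‖x‖ := by
        field_simp
        ring
      linarith
    have e3 : L * (√μ * X) * ‖d‖ ^ 2 ≤ L * ((X ^ 2 * √μ ^ 2 + 1) / 2) * ‖d‖ ^ 2 := by
      gcongr
      nlinarith [sq_nonneg (√μ * X - 1)]
    rw [hμ2] at e2 e3
    rw [hκ2] at e2
    linarith
  linarith [hL θ hθ θ' hθ' z]

end Uniform

end AdaptiveLQR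

end

/-! ### Choice of the constants and the decrease along trajectories. -/

theorem proposition2 {n m p : ℕ}
    (A : EuclideanSpace ℝ (Fin p) →ᵃ[ℝ] Matrix (Fin n) (Fin n) ℝ)
    (B : EuclideanSpace ℝ (Fin p) →ᵃ[ℝ] Matrix (Fin n) (Fin m) ℝ)
    (Q : Matrix (Fin n) (Fin n) ℝ) (hQ : Q.PosDef)
    (R : Matrix (Fin m) (Fin m) ℝ) (hR : R.PosDef)
    (Θ : Set (EuclideanSpace ℝ (Fin p))) (hΘcompact : IsCompact Θ) (hΘconvex : Convex ℝ Θ)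
    (hΘstab : ∀ θ ∈ Θ, AdaptiveLQR.IsStabilizable (A θ) (B θ))
    (W : ℝ) (hW : 0 ≤ W) :
    (∀ θ ∈ Θ, ∃! P, AdaptiveLQR.IsRiccatiSolution (A θ) (B θ) Q R P) ∧
    ∃ α ν₂ ν₃ ν₄ : ℝ, 0 < α ∧ 0 < ν₂ ∧ 0 < ν₃ ∧ 0 < ν₄ ∧
      ∀ X μ : ℝ, 0 < μ →
        ∃ β γ : ℝ, 0 < β ∧ 0 < γ ∧ β = ν₂ * μ * X ^ 2 + ν₃ * μ + ν₄ ∧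
          ∀ (x w e : ℕ → EuclideanSpace ℝ (Fin n)) (u : ℕ → EuclideanSpace ℝ (Fin m))
            (θ θhat : ℕ → EuclideanSpace ℝ (Fin p)),
            (∀ k, x (k + 1) = AdaptiveLQR.mulE (A (θ k)) (x k)
              + AdaptiveLQR.mulE (B (θ k)) (u k) + w k) →
            (∀ k, u k = AdaptiveLQR.mulE
              (AdaptiveLQR.lqrGain (A (θhat k)) (B (θhat k)) Q R) (x k)) →
            (∀ k, e k = AdaptiveLQR.predError A B (θhat k) (x k) (u k) (x (k + 1)) (w k)) →
            (∀ k, ‖w k‖ ≤ W) →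
            (∀ k, θ k ∈ Θ) →
            (∀ k, θhat k ∈ Θ) →
            (∀ k, ‖x k‖ ≤ X) →
            (∀ k, ‖θhat (k + 1) - θhat k‖ ≤ √μ * ‖e k + w k‖) →
            ∀ k, AdaptiveLQR.lyapunovV A B Q R (x (k + 1)) (θhat (k + 1))
                - AdaptiveLQR.lyapunovV A B Q R (x k) (θhat k)
              ≤ -α * ‖x k‖ ^ 2 + β * ‖e k‖ ^ 2 + γ * ‖w k‖ ^ 2 := by
  refine ⟨fun θ hθ => (hΘstab θ hθ).existsUnique_isRiccatiSolution hQ hR, ?_⟩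
  obtain ⟨q, hq, hqQ⟩ := AdaptiveLQR.exists_pos_mul_norm_sq_le hQ
  obtain ⟨r, hr, hrR⟩ := AdaptiveLQR.exists_pos_mul_norm_sq_le hR
  obtain ⟨M, hM0, hM⟩ := AdaptiveLQR.exists_riccatiP_bound hQ hR hΘcompact hΘstab
  obtain ⟨L, hL0, hL⟩ := AdaptiveLQR.exists_riccatiP_lipschitz hQ hR hΘstab hM0 hM
  set ν : ℝ := L ^ 2 * (M / q) / q + L / 2 with hν
  set ν' : ℝ := L / 2 + (1 + 4 * M / q) * M with hν'
  have hν0 : 0 < ν := by positivity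
  have hν'0 : 0 < ν' := by positivity
  -- The doubling comes from splitting `‖e k + w k‖ ^ 2`. No pure `μ` term arises, so any positive
  -- `ν₃` would do.
  refine ⟨q / 2, 2 * ν, 1, 2 * ν', by positivity, by positivity, one_pos, by positivity,
    fun X μ hμ => ?_⟩
  set β : ℝ := 2 * ν * μ * X ^ 2 + 1 * μ + 2 * ν' with hβ
  refine ⟨β, β, by positivity, by positivity, rfl, ?_⟩
  intro x w e u θ θhat hx hu he _ _ hθhat hX hupd k
  have hz : x (k + 1) = AdaptiveLQR.mulE (A (θhat k)) (x k) + AdaptiveLQR.mulE (B (θhat k))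
      (AdaptiveLQR.mulE (AdaptiveLQR.lqrGain (A (θhat k)) (B (θhat k)) Q R) (x k))
        + (e k + w k) := by
    rw [he k, AdaptiveLQR.predError, AdaptiveLQR.prediction, ← hu k]
    abel
  have hstep := AdaptiveLQR.quadForm_riccatiP_step_le hQ hR hΘstab hq hqQ hr hrR hM0 hM hL0 hL hμ
    (hθhat k) (hθhat (k + 1)) hz (hX (k + 1)) (hupd k)
  have hd : ‖e k + w k‖ ^ 2 ≤ 2 * (‖e k‖ ^ 2 + ‖w k‖ ^ 2) := by
    calc ‖e k + w k‖ ^ 2 ≤ (‖e k‖ + ‖w k‖) ^ 2 := by gcongr; exact norm_add_le _ _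
      _ ≤ _ := by nlinarith [sq_nonneg (‖e k‖ - ‖w k‖)]
  refine hstep.trans ?_
  have h1 : (ν * (X ^ 2 * μ) + ν') * ‖e k + w k‖ ^ 2
      ≤ (ν * (X ^ 2 * μ) + ν') * (2 * (‖e k‖ ^ 2 + ‖w k‖ ^ 2)) := by gcongr
  have h2 : 0 ≤ μ * (‖e k‖ ^ 2 + ‖w k‖ ^ 2) := by positivity
  have h3 : ν * (X ^ 2 * μ) + L / 2 + (1 + 4 * M / q) * M = ν * (X ^ 2 * μ) + ν' := by
    rw [hν']
    ring
  rw [h3]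
  linarith
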